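/- All inequalities and absolute values of vectors, matrices and $3$-tensors are meant entrywise. For a $3$-tensor $\mathcal T$, vectors $v$ and matrices $C,E$ put $(\mathcal Tv)_{ij}=\sum_k\mathcal T_{ijk}v_k$, $(C\mathcal T)_{ijk}=\sum_l C_{il}\mathcal T_{ljk}$, $(\mathcal TE)_{ijk}=\sum_l\mathcal T_{ijl}E_{lk}$. A slope of a map $F$ with center $y_0$ at $y$ is a matrix (a $3$-tensor, if $F$ is matrix valued) $F[y_0,y]$ with $F(y)-F(y_0)=F[y_0,y]\,(y-y_0)$. Let $X\subseteq\mathbb R^n$, $S\subseteq\mathbb R^q$, let $H\colon X\times S\to\mathbb R^n$ be differentiable with Jacobian $H'_x$ with respect to $x$, let $\mathbf x\subseteq X$ and $\mathbf s\subseteq S$ be boxes, and let $C\in\mathbb R^{n\times n}$ be a nonsingular (preconditioning) matrix. Let $\hat x\colon\mathbb R^q\to\mathbb R^n$, and let $s\in\mathbf s$ with $\hat x(s)\in\operatorname{int}(\mathbf x)$. Let $u\in\mathbb R^n$, $u>0$, be such that $$M_u(s):=\{x : |x-\hat x(s)|\le u\}\subseteq\mathbf x .$$ For $x\in M_u(s)$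 let $H_{xx}[x]\in\mathbb R^{n\times n\times n}$ be a second order slope of $H(\cdot,s)$ with center $\hat x(s)$ at $x$, i.e. $$H(x,s)-H(\hat x(s),s)=\bigl(H'_x(\hat x(s),s)+H_{xx}[x]\,(x-\hat x(s))\bigr)(x-\hat x(s)),$$ and let $\mathfrak B(s)\in\mathbb R^{n\times n\times n}$ satisfy $\mathfrak B(s)\ge|C\,H_{xx}[x]|$ for all $x\in M_u(s)$. (a) Let $\bar{\mathfrak b}(s)\ge|C\,H(\hat x(s),s)|$ and $\mathfrak B_0(s)\ge|C\,H'_x(\hat x(s),s)-\mathbb 1|$ be such that $$\bar{\mathfrak b}(s)+\bigl(\mathfrak B_0(s)+\mathfrak B(s)u\bigr)u\le u. \qquad (*)$$ Then the map $x\mapsto x-C\,H(x,s)$ maps $M_u(s)$ into itself, and there is an $x\in M_u(s)$ with $H(x,s)=0$. (b) The same conclusion holds if $(*)$ is satisfied by the following bounds, which are computed from a point $(z,p)\in\mathbf x\times\mathbf s$ with $\hat x(p)=z$: given $\bar b\ge|C\,H(z,p)|$ and $B_0\ge|C\,H'_x(z,p)-\mathbb 1|$, put $g(t)=(\hat x(t),t)$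 and $$\bar{\mathfrak b}(s)=\bar b+|(CH)[g(p),g(s)]|\;|g[p,s]|\;|s-p|,\qquad \mathfrak B_0(s)=B_0+\bigl(|C\,(H'_x)[g(p),g(s)]|\;|g[p,s]|\bigr)|s-p|,$$ where $g[p,s]=\begin{pmatrix}\hat x[p,s]\\ \mathbb 1\end{pmatrix}$ and $\hat x[p,s]$, $(CH)[g(p),g(s)]$, $(H'_x)[g(p),g(s)]$ are any slopes of $\hat x$, $CH$, $H'_x$. -/

import Mathlib

open Matrix Set

noncomputable section

namespace ParamSlopes

/-- Real `a × b × c` tensors (3-tensors), with entries `T i j k`. -/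
abbrev Tensor3 (a b c : Type*) := a → b → c → ℝ

/-- Product of a 3-tensor with a vector: `(T v) i j = ∑ k, T i j k * v k`. -/
def tensorMulVec {a b c : Type*} [Fintype c] (T : Tensor3 a b c) (v : c → ℝ) : Matrix a b ℝ :=
  Matrix.of fun i j => ∑ k, T i j k * v k

/-- Product of a matrix with a 3-tensor: `(C T) i j k = ∑ l, C i l * T l j k`. -/
def matMulTensor {a a' b c : Type*} [Fintype a'] (C : Matrix a a' ℝ) (T : Tensor3 a' b c) :
    Tensor3 a b c :=
  fun i j k => ∑ l, C i l * T l j k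

/-- Product of a 3-tensor with a matrix: `(T B) i j k = ∑ l, T i j l * B l k`. -/
def tensorMulMat {a b c d : Type*} [Fintype c] (T : Tensor3 a b c) (B : Matrix c d ℝ) :
    Tensor3 a b d :=
  fun i j k => ∑ l, T i j l * B l k

/-- Entrywise absolute value of a vector. -/
def absVec {a : Type*} (v : a → ℝ) : a → ℝ := fun i => |v i|

/-- Entrywise absolute value of a matrix. -/
def absMat {a b : Type*} (A : Matrix a b ℝ) : Matrix a b ℝ := Matrix.of fun i j => |A i j|

/-- Entrywise absolute value of a 3-tensor. -/
def absTensor {a b c : Type*} (T : Tensor3 a b c) : Tensor3 a b c := fun i j k => |T i j k|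

/-- `A` is a slope matrix for `F` with center `z` at `x`: `F x - F z = A (x - z)`. -/
def IsSlope {a b : Type*} [Fintype a] (F : (a → ℝ) → (b → ℝ)) (z x : a → ℝ)
    (A : Matrix b a ℝ) : Prop :=
  F x - F z = A *ᵥ (x - z)

/-- `T` is a (first order) slope for the matrix valued map `F` with center `z` at `x`:
`F x - F z = T (x - z)`. -/
def IsMatrixSlope {a b c : Type*} [Fintype a] (F : (a → ℝ) → Matrix b c ℝ) (z x : a → ℝ)
    (T : Tensor3 b c a) : Prop :=
  F x - F z = tensorMulVec T (x - z)

/-- `T` is a second order slope `F[z, z, x]` for `F`, where `J` is the Jacobian of `F` at `z`: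
`F[z, x] = J + T (x - z)` is a slope matrix for `F` with center `z` at `x`. -/
def IsSecondOrderSlope {a b : Type*} [Fintype a] (F : (a → ℝ) → (b → ℝ)) (J : Matrix b a ℝ)
    (z x : a → ℝ) (T : Tensor3 b a a) : Prop :=
  IsSlope F z x (J + tensorMulVec T (x - z))

/-- The Jacobian `H'_x(x, s)` of `H` with respect to `x`. The derivative is taken within the
domain `X`; at interior points of `X` it is the ordinary one. -/
def jacX {n q : ℕ} (X : Set (Fin n → ℝ)) (H : (Fin n → ℝ) → (Fin q → ℝ) → (Fin n → ℝ))
    (x : Fin n → ℝ) (s : Fin q → ℝ) : Matrix (Fin n) (Fin n) ℝ :=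
  LinearMap.toMatrix' (fderivWithin ℝ (fun x' => H x' s) X x : (Fin n → ℝ) →ₗ[ℝ] (Fin n → ℝ))

/-- The box `M_u = {x : |x - c| ≤ u}` (componentwise). -/
def centeredBox {n : ℕ} (c u : Fin n → ℝ) : Set (Fin n → ℝ) := {x | ∀ i, |x i - c i| ≤ u i}

/-- The map `g(s) = (xhat(s), s)`. -/
def graphMap {n q : ℕ} (xhat : (Fin q → ℝ) → (Fin n → ℝ)) (s : Fin q → ℝ) : Fin n ⊕ Fin q → ℝ :=
  Sum.elim (xhat s) s

/-- The slope matrix of `g` made of a slope matrix `Θ` of `xhat` and the identity matrix. -/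
def graphSlope {n q : ℕ} (Θ : Matrix (Fin n) (Fin q) ℝ) : Matrix (Fin n ⊕ Fin q) (Fin q) ℝ :=
  Matrix.fromRows Θ 1

/-- The bound `b + G₀ |s - p|` with `G₀ = |CH[g(p), g(s)]| |g[p, s]|`, where `G` is the slope
`CH[g(p), g(s)]` and `Θ` the slope `xhat[p, s]`. -/
def slopeBoundVec {n q : ℕ} (b : Fin n → ℝ) (G : Matrix (Fin n) (Fin n ⊕ Fin q) ℝ)
    (Θ : Matrix (Fin n) (Fin q) ℝ) (p s : Fin q → ℝ) : Fin n → ℝ :=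
  b + (absMat G * absMat (graphSlope Θ)) *ᵥ absVec (s - p)

/-- The bound `B₀ + A |s - p|` with `A = |C H'_x[g(p), g(s)]| |g[p, s]|`, where `D` is the slope
`H'_x[g(p), g(s)]` and `Θ` the slope `xhat[p, s]`. -/
def slopeBoundMat {n q : ℕ} (B₀ C : Matrix (Fin n) (Fin n) ℝ)
    (D : Tensor3 (Fin n) (Fin n) (Fin n ⊕ Fin q))
    (Θ : Matrix (Fin n) (Fin q) ℝ) (p s : Fin q → ℝ) : Matrix (Fin n) (Fin n) ℝ :=
  B₀ + tensorMulVec (tensorMulMat (absTensor (matMulTensor C D)) (absMat (graphSlope Θ)))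
    (absVec (s - p))

end ParamSlopes

end

open ParamSlopes

/-! Subtracting the slope identity from `x` gives, with `c = xhat s`, `x - C H(x) - c = -C H(c) - (C
J - 1 + (C T)(x - c))(x - c)`, where `J` is the Jacobian at `c` and `T` the second order slope. On
`|x - c| ≤ u` the right side is entrywise at most `b + (B₀ + B u) u ≤ u`, so the box is mapped into
itself (`mapsTo_centeredBox_sub_mulVec`). Brouwer's theorem yields a fixed point, at which `C H =
0`, hence `H = 0` because `C` is invertible. For (b), the slopes carry the bounds from `p` to `s`,
which reduces it to (a).

Brouwer's theorem comes from the absence of a C¹ retraction `f` of the ball onto its sphere. With `g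
= f - id`, the map `id + t g` permutes the ball for small `t > 0`, so the integral of `det (1 + t
g')` is the volume of the ball. The integrand is polynomial in `t`, so the same value holds at `t =
1`, where `det f' = 0`. -/

section Brouwer

/-! ### No C¹ retraction of the ball onto the sphere -/

open Metric MeasureTheory
open scoped Topology NNReal

/-- A Lipschitz map on the closed unit ball that vanishes on the unit sphere stays Lipschitz when
it is extended by zero. -/
theorem lipschitzWith_indicator_closedBall {E : Type*} [NormedAddCommGroup E] [NormedSpace ℝ E]
    {g : E → E} {K : ℝ≥0} (hg : LipschitzOnWith K g (closedBall 0 1))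
    (h0 : ∀ x : E, ‖x‖ = 1 → g x = 0) :
    LipschitzWith K ((closedBall (0 : E) 1).indicator g) := by
  have key : ∀ x y : E, ‖x‖ ≤ 1 → 1 < ‖y‖ → ‖g x‖ ≤ K * ‖x - y‖ := by
    intro x y hx hy
    -- The segment from `x` to `y` meets the sphere, where `g` vanishes; only the part up to that
    -- point contributes.
    have hc : ContinuousOn (fun t : ℝ => ‖x + t • (y - x)‖) (Icc 0 1) := by fun_prop
    obtain ⟨t, ht, hp⟩ := intermediate_value_Icc zero_le_one hc
      (show (1 : ℝ) ∈ Icc _ _ from ⟨by simpa using hx, by simpa using hy.le⟩)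
    have hp' : ‖x + t • (y - x)‖ = 1 := hp
    have := hg.norm_sub_le (show x ∈ closedBall 0 1 by simpa using hx)
      (show x + t • (y - x) ∈ closedBall 0 1 by simp [hp'])
    rw [h0 _ hp', sub_zero] at this
    refine this.trans ?_
    have e : ‖x - (x + t • (y - x))‖ = t * ‖x - y‖ := by
      rw [sub_add_cancel_left, norm_neg, norm_smul, Real.norm_of_nonneg ht.1, norm_sub_rev]
    rw [e]
    gcongr
    exact mul_le_of_le_one_left (norm_nonneg _) ht.2
  refine LipschitzWith.of_dist_le_mul fun x y => ?_
  rw [dist_eq_norm, dist_eq_norm]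
  by_cases hx : x ∈ closedBall (0 : E) 1 <;> by_cases hy : y ∈ closedBall (0 : E) 1
  · rw [indicator_of_mem hx, indicator_of_mem hy]
    exact hg.norm_sub_le hx hy
  · rw [indicator_of_mem hx, indicator_of_notMem hy, sub_zero]
    exact key x y (by simpa using hx) (by simpa using hy)
  · rw [indicator_of_notMem hx, indicator_of_mem hy, zero_sub, norm_neg, norm_sub_rev]
    exact key y x (by simpa using hy) (by simpa using hx)
  · rw [indicator_of_notMem hx, indicator_of_notMem hy]
    simp only [sub_self, norm_zero]; positivity

/-- Since `t • h` is a contraction, so is `x ↦ y - t • h x`; its fixed point is the preimage of `y`.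
-/
theorem bijective_add_smul_of_lipschitzWith {E : Type*} [NormedAddCommGroup E] [NormedSpace ℝ E]
    [CompleteSpace E] {h : E → E} {K : ℝ≥0} (hh : LipschitzWith K h) {t : ℝ} (ht0 : 0 ≤ t)
    (ht : t * K < 1) : Function.Bijective fun x => x + t • h x := by
  constructor
  · intro x y hxy
    have e : x - y = t • (h y - h x) := by
      have : x + t • h x = y + t • h y := hxy
      rw [smul_sub, sub_eq_sub_iff_add_eq_add, this, add_comm]
    have h1 : ‖x - y‖ ≤ t * K * ‖x - y‖ := by
      conv_lhs => rw [e, norm_smul, Real.norm_of_nonneg ht0]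
      rw [mul_assoc, norm_sub_rev x y]
      exact mul_le_mul_of_nonneg_left (hh.norm_sub_le y x) ht0
    have : ‖x - y‖ ≤ 0 := by nlinarith [norm_nonneg (x - y)]
    exact sub_eq_zero.1 (norm_le_zero_iff.1 this)
  · intro y
    have hc : ContractingWith (t.toNNReal * K) fun x => y - t • h x := by
      constructor
      · rw [← NNReal.coe_lt_coe]; simpa [Real.coe_toNNReal _ ht0] using ht
      · refine LipschitzWith.of_dist_le_mul fun a b => ?_
        rw [dist_sub_left, dist_eq_norm, ← smul_sub, norm_smul, Real.norm_of_nonneg ht0,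
          NNReal.coe_mul, Real.coe_toNNReal _ ht0, mul_assoc, dist_eq_norm]
        exact mul_le_mul_of_nonneg_left (hh.norm_sub_le a b) ht0
    have := hc.fixedPoint_isFixedPt
    exact ⟨hc.fixedPoint _, by
      have h2 : y - t • h _ = _ := this
      exact (sub_eq_iff_eq_add.1 h2).symm⟩

theorem Matrix.exists_natDegree_le_eval_eq_det {ι : Type*} [Fintype ι] [DecidableEq ι]
    (A B : Matrix ι ι ℝ) :
    ∃ P : Polynomial ℝ, P.natDegree ≤ Fintype.card ι ∧ ∀ t, P.eval t = (t • A + B).det := by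
  refine ⟨_, Polynomial.natDegree_det_X_add_C_le A B, fun t => ?_⟩
  rw [← Polynomial.coe_evalRingHom, RingHom.map_det]
  congr 1
  ext i j
  simp
  exact mul_comm _ _

/-- Interpolation of `det (1 + A)` by the values `det (1 + t A)` at sufficiently many nodes. -/
theorem exists_det_one_add_eq_sum {E : Type*} [NormedAddCommGroup E] [NormedSpace ℝ E]
    [FiniteDimensional ℝ E] (s : Finset ℝ) (hs : Module.finrank ℝ E < s.card) :
    ∃ c : ℝ → ℝ, ∑ t ∈ s, c t = 1 ∧ ∀ A : E →L[ℝ] E,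
      (ContinuousLinearMap.id ℝ E + A).det =
        ∑ t ∈ s, c t * (ContinuousLinearMap.id ℝ E + t • A).det := by
  have hv : Set.InjOn (id : ℝ → ℝ) s := Function.injective_id.injOn
  -- The weights do not depend on `A`, so the identity can later be integrated term by term.
  refine ⟨fun t => (Lagrange.basis s id t).eval 1, ?_, fun A => ?_⟩
  · rw [← Polynomial.eval_finsetSum, Lagrange.sum_basis hv (Finset.card_pos.1 (by omega)),
      Polynomial.eval_one]
  · let b := Module.finBasis ℝ E
    have hdet : ∀ t : ℝ, (ContinuousLinearMap.id ℝ E + t • A).det =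
        (t • LinearMap.toMatrix b b (A : E →ₗ[ℝ] E) + 1).det := by
      intro t
      rw [ContinuousLinearMap.det, ← LinearMap.det_toMatrix b]
      congr 1
      rw [ContinuousLinearMap.toLinearMap_add, ContinuousLinearMap.toLinearMap_smul, map_add,
        map_smul, add_comm]
      congr 1
      exact LinearMap.toMatrix_id b
    obtain ⟨P, hP, hPe⟩ :=
      Matrix.exists_natDegree_le_eval_eq_det (LinearMap.toMatrix b b (A : E →ₗ[ℝ] E)) 1
    have hdeg : P.degree < s.card := by
      refine P.degree_le_natDegree.trans_lt ?_
      rw [Fintype.card_fin] at hP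
      exact_mod_cast hP.trans_lt hs
    have h1 := hdet 1
    rw [one_smul] at h1
    simp only [h1, hdet, ← hPe]
    conv_lhs => rw [Lagrange.eq_interpolate hv hdeg, Lagrange.interpolate_apply]
    simp [Polynomial.eval_finsetSum, mul_comm]

variable {E : Type*} [NormedAddCommGroup E] [InnerProductSpace ℝ E] [FiniteDimensional ℝ E]

/-- The derivative of a map into the unit sphere is singular. -/
theorem det_fderiv_eq_zero_of_norm_eq_one {f : E → E} {x : E} (hf : DifferentiableAt ℝ f x)
    (h1 : ∀ᶠ y in 𝓝 x, ‖f y‖ = 1) : (fderiv ℝ f x).det = 0 := by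
  by_contra hdet
  -- Differentiating `‖f‖² = 1` makes the range of the derivative orthogonal to `f x`; an invertible
  -- derivative would attain `f x` itself.
  have hinner : ∀ v, inner ℝ (f x) (fderiv ℝ f x v) = 0 := by
    intro v
    have hd := hf.hasFDerivAt.inner ℝ hf.hasFDerivAt
    have hc : HasFDerivAt (fun y => inner ℝ (f y) (f y)) (0 : E →L[ℝ] ℝ) x := by
      refine (hasFDerivAt_const (1 : ℝ) x).congr_of_eventuallyEq ?_
      filter_upwards [h1] with y hy
      rw [real_inner_self_eq_norm_sq, hy, one_pow]
    have := DFunLike.congr_fun (hd.unique hc) v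
    simp [real_inner_comm (fderiv ℝ f x v)] at this
    simpa [real_inner_comm] using this
  have hsurj := LinearMap.range_eq_top.1
    ((LinearMap.equivOfDetNeZero (fderiv ℝ f x : E →ₗ[ℝ] E) hdet).range)
  obtain ⟨v, hv⟩ := hsurj (f x)
  have hv' : fderiv ℝ f x v = f x := hv
  have := hinner v
  rw [hv', real_inner_self_eq_norm_sq, h1.self_of_nhds] at this
  norm_num at this

variable [MeasurableSpace E] [BorelSpace E]

theorem not_exists_contDiff_retraction (f : E → E)
    (hf : ∀ x ∈ closedBall (0 : E) 1, ContDiffAt ℝ 1 f x)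
    (hnorm : ∀ x ∈ closedBall (0 : E) 1, ‖f x‖ = 1) (hid : ∀ x : E, ‖x‖ = 1 → f x = x) :
    False := by
  set g : E → E := fun x => f x - x with hgdef
  have hgd : ∀ x ∈ closedBall (0 : E) 1, DifferentiableAt ℝ g x := fun x hx =>
    ((hf x hx).differentiableAt one_ne_zero).sub differentiableAt_id
  have hgc : ContinuousOn (fderiv ℝ g) (closedBall (0 : E) 1) := fun x hx =>
    (((hf x hx).sub contDiffAt_id).continuousAt_fderiv one_ne_zero).continuousWithinAt
  obtain ⟨K₀, hK₀⟩ := (isCompact_closedBall (0 : E) 1).exists_bound_of_continuousOn hgc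
  -- The `+ 1` makes `K` positive, for the division by `K` that bounds the nodes.
  set K : ℝ≥0 := K₀.toNNReal + 1 with hK
  have hKb : ∀ x ∈ closedBall (0 : E) 1, ‖fderiv ℝ g x‖₊ ≤ K := fun x hx => by
    rw [← NNReal.coe_le_coe, hK]
    push_cast
    exact (hK₀ x hx).trans ((Real.le_coe_toNNReal K₀).trans (by linarith))
  have hlip : LipschitzOnWith K g (closedBall (0 : E) 1) :=
    (convex_closedBall (0 : E) 1).lipschitzOnWith_of_nnnorm_fderiv_le hgd hKb
  have hlip' := lipschitzWith_indicator_closedBall hlip fun x hx => by simp [hgdef, hid x hx]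
  have hK0 : (0 : ℝ) < K := by rw [hK]; positivity
  -- Positivity of the determinant removes the absolute value in the change of variables.
  obtain ⟨δ, hδ, hdet⟩ : ∃ δ > 0, ∀ A : E →L[ℝ] E, ‖A‖ < δ →
      0 < (ContinuousLinearMap.id ℝ E + A).det := by
    have hc : ContinuousAt (fun A : E →L[ℝ] E => (ContinuousLinearMap.id ℝ E + A).det) 0 :=
      (ContinuousLinearMap.continuous_det.comp (continuous_const.add continuous_id)).continuousAt
    have := hc.eventually (lt_mem_nhds (show (0 : ℝ) < _ by
      simp [ContinuousLinearMap.det]))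
    obtain ⟨δ, hδ, h⟩ := Metric.eventually_nhds_iff.1 this
    exact ⟨δ, hδ, fun A hA => h (by simpa using hA)⟩
  have hvol : ∀ t : ℝ, 0 < t → t * K < 1 → t * K < δ →
      IntegrableOn (fun x => (ContinuousLinearMap.id ℝ E + t • fderiv ℝ g x).det)
        (ball (0 : E) 1) ∧
      ∫ x in ball (0 : E) 1, (ContinuousLinearMap.id ℝ E + t • fderiv ℝ g x).det =
        volume.real (ball (0 : E) 1) := by
    intro t ht0 ht1 ht2
    have hbij := bijective_add_smul_of_lipschitzWith hlip' ht0.le ht1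
    set φ : E → E := fun x => x + t • (closedBall (0 : E) 1).indicator g x
    have hφout : ∀ x ∉ ball (0 : E) 1, φ x = x := by
      intro x hx
      have hx' : 1 ≤ ‖x‖ := by simpa using hx
      suffices (closedBall (0 : E) 1).indicator g x = 0 by simp [φ, this]
      by_cases h : x ∈ closedBall (0 : E) 1
      · rw [indicator_of_mem h]
        simp [hgdef, hid x (le_antisymm (by simpa using h) hx')]
      · exact indicator_of_notMem h _
    have himg : φ '' ball (0 : E) 1 = ball (0 : E) 1 := by
      -- A bijection of `E` that is the identity off the ball must preserve the ball.
      have hco : φ '' (ball (0 : E) 1)ᶜ = (ball (0 : E) 1)ᶜ := by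
        conv_rhs => rw [← image_id (ball (0 : E) 1)ᶜ]
        exact image_congr hφout
      rw [image_compl_eq hbij] at hco
      exact compl_injective hco
    have hder : ∀ x ∈ ball (0 : E) 1, HasFDerivWithinAt φ
        (ContinuousLinearMap.id ℝ E + t • fderiv ℝ g x) (ball (0 : E) 1) x := by
      intro x hx
      have h1 : HasFDerivAt (fun x => x + t • g x)
          (ContinuousLinearMap.id ℝ E + t • fderiv ℝ g x) x :=
        (hasFDerivAt_id x).add ((hgd x (ball_subset_closedBall hx)).hasFDerivAt.const_smul t)
      refine h1.hasFDerivWithinAt.congr (fun y hy => ?_) ?_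
      · simp only [φ, indicator_of_mem (ball_subset_closedBall hy)]
      · simp only [φ, indicator_of_mem (ball_subset_closedBall hx)]
    have hpos : ∀ x ∈ ball (0 : E) 1,
        |(ContinuousLinearMap.id ℝ E + t • fderiv ℝ g x).det| • (1 : ℝ) =
          (ContinuousLinearMap.id ℝ E + t • fderiv ℝ g x).det := by
      intro x hx
      rw [smul_eq_mul, mul_one, abs_of_pos]
      refine hdet _ (lt_of_le_of_lt ?_ ht2)
      rw [norm_smul, Real.norm_of_nonneg ht0.le]
      exact mul_le_mul_of_nonneg_left (hKb x (ball_subset_closedBall hx)) ht0.le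
    constructor
    · have := (integrableOn_image_iff_integrableOn_abs_det_fderiv_smul volume measurableSet_ball
        hder hbij.injective.injOn (fun _ => (1 : ℝ))).1
        (by rw [himg]; exact integrableOn_const measure_ball_lt_top.ne)
      exact this.congr_fun hpos measurableSet_ball
    · have := integral_image_eq_integral_abs_det_fderiv_smul volume measurableSet_ball
        hder hbij.injective.injOn (fun _ => (1 : ℝ))
      rw [himg, setIntegral_congr_fun measurableSet_ball hpos] at this
      rw [← this]
      simp
  obtain ⟨s, hs, hcard⟩ := (Set.Ioo_infinite
    (show (0 : ℝ) < min 1 δ / K by positivity)).exists_subset_card_eq (Module.finrank ℝ E + 1)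
  have hs' : ∀ t ∈ s, 0 < t ∧ t * K < 1 ∧ t * K < δ := fun t ht => by
    have := hs ht
    have h2 := (lt_div_iff₀ hK0).1 this.2
    exact ⟨this.1, h2.trans_le (min_le_left _ _), h2.trans_le (min_le_right _ _)⟩
  obtain ⟨c, hc1, hc⟩ := exists_det_one_add_eq_sum (E := E) s (by omega)
  have hzero : ∫ x in ball (0 : E) 1, (ContinuousLinearMap.id ℝ E + fderiv ℝ g x).det = 0 := by
    refine setIntegral_eq_zero_of_forall_eq_zero fun x hx => ?_
    have hfd := (hf x (ball_subset_closedBall hx)).differentiableAt one_ne_zero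
    have : fderiv ℝ g x = fderiv ℝ f x - ContinuousLinearMap.id ℝ E :=
      (hfd.hasFDerivAt.sub (hasFDerivAt_id x)).fderiv
    rw [this, add_sub_cancel]
    refine det_fderiv_eq_zero_of_norm_eq_one hfd ?_
    filter_upwards [isOpen_ball.mem_nhds hx] with y hy using hnorm y (ball_subset_closedBall hy)
  have hsum : ∫ x in ball (0 : E) 1, (ContinuousLinearMap.id ℝ E + fderiv ℝ g x).det =
      volume.real (ball (0 : E) 1) := by
    rw [integral_congr_ae (Filter.Eventually.of_forall fun x => hc (fderiv ℝ g x))]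
    rw [integral_finsetSum]
    · trans ∑ t ∈ s, c t * volume.real (ball (0 : E) 1)
      swap
      · rw [← Finset.sum_mul, hc1, one_mul]
      refine Finset.sum_congr rfl fun t ht => ?_
      obtain ⟨h0, h1, h2⟩ := hs' t ht
      rw [integral_const_mul, (hvol t h0 h1 h2).2]
    · intro t ht
      obtain ⟨h0, h1, h2⟩ := hs' t ht
      exact (hvol t h0 h1 h2).1.const_mul _
  have hpos : 0 < volume.real (ball (0 : E) 1) :=
    ENNReal.toReal_pos (measure_ball_pos volume 0 one_pos).ne' measure_ball_lt_top.ne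
  linarith

end Brouwer

/-! ### Brouwer's theorem, from smooth maps of the ball to continuous maps of boxes -/

section Brouwer

open Metric MeasureTheory
open scoped Topology NNReal

variable {E : Type*} [NormedAddCommGroup E] [InnerProductSpace ℝ E] [FiniteDimensional ℝ E]

/-- Brouwer's fixed point theorem for smooth maps of the closed unit ball. -/
theorem exists_fixedPoint_of_contDiff {F : E → E} (hF : ContDiff ℝ 1 F)
    (hmaps : ∀ x : E, ‖x‖ ≤ 1 → ‖F x‖ ≤ 1) : ∃ x : E, ‖x‖ ≤ 1 ∧ F x = x := by
  let _ : MeasurableSpace E := borel E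
  have : BorelSpace E := ⟨rfl⟩
  by_contra! hne
  -- The ray from `F x` through `x` leaves the ball at `x + lam x • w x`; `lam` is the larger root
  -- of `‖x + λ w‖² = 1`, and `disc` a quarter of its discriminant. On the sphere `β ≥ ‖w‖² / 2 >
  -- 0`, which keeps the root smooth and gives `lam = 0` there.
  let w : E → E := fun x => x - F x
  let β : E → ℝ := fun x => inner ℝ x (w x)
  let disc : E → ℝ := fun x => β x ^ 2 + ‖w x‖ ^ 2 * (1 - ‖x‖ ^ 2)
  let lam : E → ℝ := fun x => (-β x + √(disc x)) / ‖w x‖ ^ 2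
  have hw : ∀ x : E, ‖x‖ ≤ 1 → 0 < ‖w x‖ ^ 2 := fun x hx => by
    have : w x ≠ 0 := sub_ne_zero.2 (hne x hx).symm
    positivity
  have hβ : ∀ x : E, ‖x‖ = 1 → 0 < β x := by
    intro x hx
    have h1 : 0 < ‖w x‖ ^ 2 := hw x hx.le
    have h2 : ‖w x‖ ^ 2 = ‖x‖ ^ 2 - 2 * inner ℝ x (F x) + ‖F x‖ ^ 2 := norm_sub_sq_real x (F x)
    have h3 : β x = ‖x‖ ^ 2 - inner ℝ x (F x) := by
      simp only [β, w, inner_sub_right, real_inner_self_eq_norm_sq]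
    have h4 := hmaps x hx.le
    have h5 : ‖F x‖ ^ 2 ≤ 1 := pow_le_one₀ (norm_nonneg _) h4
    rw [hx] at h2 h3
    linarith
  have hdisc : ∀ x : E, ‖x‖ ≤ 1 → 0 < disc x := by
    intro x hx
    rcases hx.eq_or_lt with h | h
    · have := hβ x h
      simp only [disc, h]
      nlinarith
    · have : 0 < ‖w x‖ ^ 2 * (1 - ‖x‖ ^ 2) :=
        mul_pos (hw x hx) (sub_pos.2 (pow_lt_one₀ (norm_nonneg _) h two_ne_zero))
      have := sq_nonneg (β x)
      simp only [disc]
      linarith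
  have hwc : ContDiff ℝ 1 w := contDiff_id.sub hF
  have hβc : ContDiff ℝ 1 β := contDiff_id.inner ℝ hwc
  have hdc : ContDiff ℝ 1 disc :=
    (hβc.pow 2).add ((hwc.norm_sq ℝ).mul (contDiff_const.sub (contDiff_id.norm_sq ℝ)))
  refine not_exists_contDiff_retraction (fun x => x + lam x • w x) ?_ ?_ ?_
  · intro x hx
    have hx' : ‖x‖ ≤ 1 := by simpa using hx
    have hl : ContDiffAt ℝ 1 lam x :=
      (hβc.contDiffAt.neg.add (hdc.contDiffAt.sqrt (hdisc x hx').ne')).div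
        (hwc.norm_sq ℝ).contDiffAt (hw x hx').ne'
    exact contDiffAt_id.add (hl.smul hwc.contDiffAt)
  · intro x hx
    have hx' : ‖x‖ ≤ 1 := by simpa using hx
    have h1 : ‖x + lam x • w x‖ ^ 2 = 1 := by
      rw [norm_add_sq_real, inner_smul_right, norm_smul, mul_pow, Real.norm_eq_abs, sq_abs]
      have hs := Real.sq_sqrt (hdisc x hx').le
      have hl : lam x * ‖w x‖ ^ 2 = -β x + √(disc x) := div_mul_cancel₀ _ (hw x hx').ne'
      change ‖x‖ ^ 2 + 2 * (lam x * β x) + lam x ^ 2 * ‖w x‖ ^ 2 = 1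
      have hd : disc x = β x ^ 2 + ‖w x‖ ^ 2 * (1 - ‖x‖ ^ 2) := rfl
      apply mul_left_cancel₀ (hw x hx').ne'
      linear_combination (2 * β x + lam x * ‖w x‖ ^ 2 - β x + √(disc x)) * hl + hs + hd
    exact (pow_eq_one_iff_of_nonneg (norm_nonneg _) two_ne_zero).1 h1
  · intro x hx
    have hd : √(disc x) = β x := by
      have : disc x = β x ^ 2 := by simp [disc, hx]
      rw [this, Real.sqrt_sq (hβ x hx).le]
    simp [lam, hd]

/-- Brouwer's fixed point theorem for the closed unit ball. -/
theorem exists_fixedPoint_of_norm_le_one {F : E → E} (hF : Continuous F)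
    (hmaps : ∀ x : E, ‖F x‖ ≤ 1) : ∃ x : E, F x = x := by
  by_contra! hne
  obtain ⟨x₀, -, hx₀⟩ := (isCompact_closedBall (0 : E) 1).exists_isMinOn
    ⟨0, by simp⟩ (hF.sub continuous_id).norm.continuousOn
  set δ := ‖F x₀ - x₀‖ with hδ
  have hδ0 : 0 < δ := norm_pos_iff.2 (sub_ne_zero.2 (hne x₀))
  -- Dividing `G` by `1 + δ / 4` returns it to the ball; a fixed point of the quotient is moved by
  -- `F` less than `δ / 2`, below the minimal displacement `δ`.
  obtain ⟨G, hG, hGF, -⟩ := hF.exists_contDiff_approx (ε := fun _ => δ / 4) 1 continuous_const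
    fun _ => by positivity
  have hGn : ∀ x, ‖G x‖ ≤ 1 + δ / 4 := fun x => by
    have h1 := hGF x
    rw [dist_eq_norm] at h1
    have := norm_le_norm_add_norm_sub' (G x) (F x)
    linarith [hmaps x]
  have hpos : 0 < 1 + δ / 4 := by positivity
  obtain ⟨x, hx, hfix⟩ := exists_fixedPoint_of_contDiff (F := fun x => (1 + δ / 4)⁻¹ • G x)
    (contDiff_const.smul hG) fun x _ => by
      rw [norm_smul, norm_inv, Real.norm_of_nonneg hpos.le, inv_mul_le_one₀ hpos]
      exact hGn x
  have hGx : G x = (1 + δ / 4) • x := (inv_smul_eq_iff₀ hpos.ne').1 hfix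
  have h1 : δ ≤ ‖F x - x‖ := hx₀ (by simpa using hx)
  have h2 := hGF x
  rw [dist_eq_norm] at h2
  have h3 : G x - x = (δ / 4) • x := by rw [hGx, add_smul, one_smul, add_sub_cancel_left]
  have h4 : ‖G x - x‖ ≤ δ / 4 := by
    rw [h3, norm_smul, Real.norm_of_nonneg (by positivity)]
    exact mul_le_of_le_one_right (by positivity) hx
  have h5 : ‖F x - x‖ ≤ ‖G x - x‖ + ‖G x - F x‖ := by
    rw [show F x - x = (G x - x) - (G x - F x) by abel]
    exact norm_sub_le _ _
  linarith

/-- Brouwer's fixed point theorem for bounded continuous maps. -/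
theorem exists_fixedPoint_of_norm_le {F : E → E} (hF : Continuous F) {R : ℝ} (hR : 0 < R)
    (hmaps : ∀ x : E, ‖F x‖ ≤ R) : ∃ x : E, F x = x := by
  obtain ⟨x, hx⟩ := exists_fixedPoint_of_norm_le_one (F := fun x => R⁻¹ • F (R • x))
    (by fun_prop) fun x => by
      rw [norm_smul, norm_inv, Real.norm_of_nonneg hR.le, inv_mul_le_one₀ hR]
      exact hmaps _
  exact ⟨R • x, (inv_smul_eq_iff₀ hR.ne').1 hx⟩

/-- Brouwer's fixed point theorem for boxes. -/
theorem exists_fixedPoint_of_mapsTo_Icc {ι : Type*} [Fintype ι] {l r : ι → ℝ} (hlr : l ≤ r)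
    {f : (ι → ℝ) → ι → ℝ} (hf : ContinuousOn f (Icc l r)) (hmaps : MapsTo f (Icc l r) (Icc l r)) :
    ∃ x ∈ Icc l r, f x = x := by
  -- Clamping coordinates retracts the space onto the box, so `f ∘ P` is defined everywhere and its
  -- fixed points lie in the box.
  let P : (ι → ℝ) → ι → ℝ := fun x => l ⊔ (r ⊓ x)
  have hPmem : ∀ x, P x ∈ Icc l r := fun x => ⟨le_sup_left, sup_le hlr inf_le_left⟩
  have hPid : ∀ x ∈ Icc l r, P x = x := fun x hx => by
    simp only [P, inf_eq_right.2 hx.2, sup_eq_right.2 hx.1]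
  have hPc : Continuous P := continuous_pi fun i =>
    continuous_const.sup (continuous_const.inf (continuous_apply i))
  let e := EuclideanSpace.equiv ι ℝ
  have hc : Continuous fun x => e.symm (f (P (e x))) :=
    e.symm.continuous.comp
      (hf.comp_continuous (hPc.comp e.continuous) fun x => hPmem _)
  obtain ⟨R, hR⟩ := ((isCompact_Icc (a := l) (b := r)).image e.symm.continuous).isBounded
    |>.exists_norm_le
  obtain ⟨x, hx⟩ := exists_fixedPoint_of_norm_le hc (R := max R 1) (by positivity) fun x =>
    (hR _ (mem_image_of_mem _ (hmaps (hPmem _)))).trans (le_max_left _ _)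
  have hx' : f (P (e x)) = e x := (e.symm_apply_eq).1 hx
  have hmem : e x ∈ Icc l r := hx' ▸ hmaps (hPmem _)
  exact ⟨e x, hmem, by rwa [hPid _ hmem] at hx'⟩

end Brouwer

/-! ### Slope estimates and the existence test -/

namespace ParamSlopes

variable {n q : ℕ}

theorem centeredBox_eq_Icc (c u : Fin n → ℝ) : centeredBox c u = Icc (c - u) (c + u) := by
  ext x
  simp only [centeredBox, mem_ofPred_eq, mem_Icc, Pi.le_def, ← forall_and, abs_le, Pi.sub_apply,
    Pi.add_apply]
  exact forall_congr' fun i => by constructor <;> rintro ⟨h1, h2⟩ <;> constructor <;> linarith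

theorem abs_mulVec_le {a b : Type*} [Fintype b] {A M : Matrix a b ℝ} {v w : b → ℝ}
    (hA : ∀ i j, |A i j| ≤ M i j) (hv : ∀ j, |v j| ≤ w j) (i : a) :
    |(A *ᵥ v) i| ≤ (M *ᵥ w) i := by
  simp only [mulVec, dotProduct]
  refine (Finset.abs_sum_le_sum_abs _ _).trans (Finset.sum_le_sum fun j _ => ?_)
  rw [abs_mul]
  exact mul_le_mul (hA i j) (hv j) (abs_nonneg _) ((abs_nonneg _).trans (hA i j))

theorem abs_tensorMulVec_le {a b c : Type*} [Fintype c] {T B : Tensor3 a b c} {v w : c → ℝ}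
    (hT : ∀ i j k, |T i j k| ≤ B i j k) (hv : ∀ k, |v k| ≤ w k) (i : a) (j : b) :
    |tensorMulVec T v i j| ≤ tensorMulVec B w i j :=
  abs_mulVec_le (A := fun j k => T i j k) (M := fun j k => B i j k) (hT i) hv j

theorem mul_tensorMulVec {a a' b c : Type*} [Fintype a'] [Fintype c] (C : Matrix a a' ℝ)
    (T : Tensor3 a' b c) (v : c → ℝ) :
    C * tensorMulVec T v = tensorMulVec (matMulTensor C T) v := by
  ext i j
  simp only [mul_apply, tensorMulVec, matMulTensor, of_apply, Finset.mul_sum, Finset.sum_mul]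
  rw [Finset.sum_comm]
  simp only [mul_assoc]

theorem tensorMulVec_mulVec {a b c d : Type*} [Fintype c] [Fintype d] (T : Tensor3 a b c)
    (M : Matrix c d ℝ) (v : d → ℝ) :
    tensorMulVec T (M *ᵥ v) = tensorMulVec (tensorMulMat T M) v := by
  ext i j
  simp only [tensorMulVec, tensorMulMat, mulVec, dotProduct, of_apply, Finset.mul_sum,
    Finset.sum_mul]
  rw [Finset.sum_comm]
  simp only [mul_assoc]

theorem graphMap_sub {xhat : (Fin q → ℝ) → Fin n → ℝ} {p s : Fin q → ℝ}
    {Θ : Matrix (Fin n) (Fin q) ℝ} (h : IsSlope xhat p s Θ) :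
    graphMap xhat s - graphMap xhat p = graphSlope Θ *ᵥ (s - p) := by
  unfold IsSlope at h
  rw [graphSlope, fromRows_mulVec, ← h, one_mulVec]
  ext (i | i) <;> simp [graphMap]

theorem abs_graphMap_sub_le {xhat : (Fin q → ℝ) → Fin n → ℝ} {p s : Fin q → ℝ}
    {Θ : Matrix (Fin n) (Fin q) ℝ} (h : IsSlope xhat p s Θ) (i : Fin n ⊕ Fin q) :
    |(graphMap xhat s - graphMap xhat p) i| ≤ (absMat (graphSlope Θ) *ᵥ absVec (s - p)) i := by
  rw [graphMap_sub h]
  exact abs_mulVec_le (fun _ _ => le_rfl) (fun _ => le_rfl) i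

theorem mapsTo_centeredBox_sub_mulVec {f : (Fin n → ℝ) → Fin n → ℝ} {C J : Matrix (Fin n) (Fin n) ℝ}
    {c u b : Fin n → ℝ} {T : (Fin n → ℝ) → Tensor3 (Fin n) (Fin n) (Fin n)}
    {B : Tensor3 (Fin n) (Fin n) (Fin n)} {B₀ : Matrix (Fin n) (Fin n) ℝ}
    (hT : ∀ x ∈ centeredBox c u, IsSecondOrderSlope f J c x (T x))
    (hB : ∀ x ∈ centeredBox c u, ∀ i j k, |matMulTensor C (T x) i j k| ≤ B i j k)
    (hb : ∀ i, |(C *ᵥ f c) i| ≤ b i) (hB₀ : ∀ i j, |(C * J - 1) i j| ≤ B₀ i j)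
    (hle : ∀ i, b i + ((B₀ + tensorMulVec B u) *ᵥ u) i ≤ u i) :
    MapsTo (fun x => x - C *ᵥ f x) (centeredBox c u) (centeredBox c u) := by
  intro x hx i
  have hxi : ∀ i, |(x - c) i| ≤ u i := hx
  have hslope : f x - f c = (J + tensorMulVec (T x) (x - c)) *ᵥ (x - c) := hT x hx
  have hfx : x - C *ᵥ f x - c = -(C *ᵥ f c) -
      (C * J - 1 + tensorMulVec (matMulTensor C (T x)) (x - c)) *ᵥ (x - c) := by
    rw [sub_eq_iff_eq_add.1 hslope, mulVec_add, mulVec_mulVec, mul_add, mul_tensorMulVec,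
      sub_add_eq_add_sub, sub_mulVec, one_mulVec]
    abel
  have hmat : ∀ i j, |(C * J - 1 + tensorMulVec (matMulTensor C (T x)) (x - c)) i j| ≤
      (B₀ + tensorMulVec B u) i j := fun i j =>
    (abs_add_le _ _).trans (add_le_add (hB₀ i j) (abs_tensorMulVec_le (hB x hx) hxi i j))
  change |(x - C *ᵥ f x - c) i| ≤ u i
  rw [hfx]
  refine le_trans ((abs_sub _ _).trans (add_le_add ?_ (abs_mulVec_le hmat hxi i))) (hle i)
  rw [Pi.neg_apply, abs_neg]
  exact hb i

theorem exists_zero_of_mapsTo_centeredBox {f : (Fin n → ℝ) → Fin n → ℝ}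
    {C : Matrix (Fin n) (Fin n) ℝ} (hC : IsUnit C) {c u : Fin n → ℝ} (hu : ∀ i, 0 ≤ u i)
    (hf : ContinuousOn f (centeredBox c u))
    (hmaps : MapsTo (fun x => x - C *ᵥ f x) (centeredBox c u) (centeredBox c u)) :
    ∃ x ∈ centeredBox c u, f x = 0 := by
  have hcont : ContinuousOn (fun x => x - C *ᵥ f x) (centeredBox c u) :=
    continuousOn_id.sub ((Continuous.matrix_mulVec continuous_const continuous_id).comp_continuousOn
      hf)
  rw [centeredBox_eq_Icc] at *
  obtain ⟨x, hx, hfix⟩ := exists_fixedPoint_of_mapsTo_Icc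
    (fun i => by simp only [Pi.sub_apply, Pi.add_apply]; linarith [hu i]) hcont hmaps
  refine ⟨x, hx, mulVec_injective_of_isUnit hC ?_⟩
  rw [mulVec_zero]
  exact sub_eq_self.1 hfix

/-- The slope of `C H` along the graph, chained with `g(s) - g(p) = g[p, s] (s - p)`, bounds the
change from `p` to `s`. -/
theorem abs_mulVec_le_slopeBoundVec {H : (Fin n → ℝ) → (Fin q → ℝ) → Fin n → ℝ}
    {C : Matrix (Fin n) (Fin n) ℝ} {xhat : (Fin q → ℝ) → Fin n → ℝ} {p s : Fin q → ℝ}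
    {b : Fin n → ℝ} {Θ : Matrix (Fin n) (Fin q) ℝ} {G : Matrix (Fin n) (Fin n ⊕ Fin q) ℝ}
    (hb : ∀ i, |(C *ᵥ H (xhat p) p) i| ≤ b i) (hΘ : IsSlope xhat p s Θ)
    (hG : IsSlope (fun y : Fin n ⊕ Fin q → ℝ => C *ᵥ H (y ∘ Sum.inl) (y ∘ Sum.inr))
      (graphMap xhat p) (graphMap xhat s) G) (i : Fin n) :
    |(C *ᵥ H (xhat s) s) i| ≤ slopeBoundVec b G Θ p s i := by
  have h : C *ᵥ H (xhat s) s - C *ᵥ H (xhat p) p = G *ᵥ (graphMap xhat s - graphMap xhat p) := hG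
  rw [sub_eq_iff_eq_add'.1 h, slopeBoundVec, ← mulVec_mulVec]
  exact (abs_add_le _ _).trans (add_le_add (hb i)
    (abs_mulVec_le (fun _ _ => le_rfl) (abs_graphMap_sub_le hΘ) i))

theorem abs_mul_jacX_sub_one_le_slopeBoundMat {X : Set (Fin n → ℝ)}
    {H : (Fin n → ℝ) → (Fin q → ℝ) → Fin n → ℝ}
    {C B₀ : Matrix (Fin n) (Fin n) ℝ} {xhat : (Fin q → ℝ) → Fin n → ℝ} {p s : Fin q → ℝ}
    {Θ : Matrix (Fin n) (Fin q) ℝ} {D : Tensor3 (Fin n) (Fin n) (Fin n ⊕ Fin q)}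
    (hB₀ : ∀ i j, |(C * jacX X H (xhat p) p - 1) i j| ≤ B₀ i j) (hΘ : IsSlope xhat p s Θ)
    (hD : IsMatrixSlope (fun y : Fin n ⊕ Fin q → ℝ => jacX X H (y ∘ Sum.inl) (y ∘ Sum.inr))
      (graphMap xhat p) (graphMap xhat s) D) (i j : Fin n) :
    |(C * jacX X H (xhat s) s - 1) i j| ≤ slopeBoundMat B₀ C D Θ p s i j := by
  have h : jacX X H (xhat s) s - jacX X H (xhat p) p =
    tensorMulVec D (graphMap xhat s - graphMap xhat p) := hD
  rw [sub_eq_iff_eq_add'.1 h, slopeBoundMat, mul_add, mul_tensorMulVec, add_sub_right_comm,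
    ← tensorMulVec_mulVec]
  exact (abs_add_le _ _).trans (add_le_add (hB₀ i j)
    (abs_tensorMulVec_le (fun _ _ _ => le_rfl) (abs_graphMap_sub_le hΘ) i j))

end ParamSlopes

theorem mainTheorem3 {n q : ℕ}
    -- the system, defined and differentiable on `X × S`
    (X : Set (Fin n → ℝ)) (S : Set (Fin q → ℝ))
    (H : (Fin n → ℝ) → (Fin q → ℝ) → (Fin n → ℝ))
    (hH : DifferentiableOn ℝ (fun y : (Fin n → ℝ) × (Fin q → ℝ) => H y.1 y.2) (X ×ˢ S))
    -- the boxes `𝐱 = [xl, xu] ⊆ X` and `𝐬 = [sl, su] ⊆ S`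
    (xl xu : Fin n → ℝ) (hxX : Set.Icc xl xu ⊆ X)
    (sl su : Fin q → ℝ) (hsS : Set.Icc sl su ⊆ S)
    -- the preconditioning matrix
    (C : Matrix (Fin n) (Fin n) ℝ) (hC : IsUnit C)
    -- the approximation function and the parameter
    (xhat : (Fin q → ℝ) → (Fin n → ℝ)) (s : Fin q → ℝ) (hs : s ∈ Set.Icc sl su)
    (hxs : xhat s ∈ interior (Set.Icc xl xu))
    -- the vector `u` and the box `M_u(s)`
    (u : Fin n → ℝ) (hu : ∀ i, 0 < u i)
    (hM : centeredBox (xhat s) u ⊆ Set.Icc xl xu)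
    -- the second order slopes with center `(xhat(s), s)`, and their bound on `M_u(s)`
    (Hxx : (Fin n → ℝ) → Tensor3 (Fin n) (Fin n) (Fin n))
    (hHxx : ∀ x ∈ centeredBox (xhat s) u,
      IsSecondOrderSlope (fun x' => H x' s) (jacX X H (xhat s) s) (xhat s) x (Hxx x))
    (B : Tensor3 (Fin n) (Fin n) (Fin n))
    (hB : ∀ x ∈ centeredBox (xhat s) u, ∀ i j k, |matMulTensor C (Hxx x) i j k| ≤ B i j k) :
    -- arbitrary upper bounds at the parameter `s`
    (∀ (b : Fin n → ℝ) (B₀ : Matrix (Fin n) (Fin n) ℝ),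
      (∀ i, |(C *ᵥ H (xhat s) s) i| ≤ b i) →
      (∀ i j, |(C * jacX X H (xhat s) s - 1) i j| ≤ B₀ i j) →
      (∀ i, b i + ((B₀ + tensorMulVec B u) *ᵥ u) i ≤ u i) →
      Set.MapsTo (fun x => x - C *ᵥ H x s) (centeredBox (xhat s) u) (centeredBox (xhat s) u) ∧
        ∃ x ∈ centeredBox (xhat s) u, H x s = 0) ∧
    -- the upper bounds obtained by slopes from those at `(z, p)`
    (∀ (z : Fin n → ℝ) (p : Fin q → ℝ), z ∈ Set.Icc xl xu → p ∈ Set.Icc sl su → xhat p = z →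
      ∀ (b : Fin n → ℝ) (B₀ : Matrix (Fin n) (Fin n) ℝ),
      (∀ i, |(C *ᵥ H z p) i| ≤ b i) →
      (∀ i j, |(C * jacX X H z p - 1) i j| ≤ B₀ i j) →
      ∀ (Θ : Matrix (Fin n) (Fin q) ℝ) (G : Matrix (Fin n) (Fin n ⊕ Fin q) ℝ)
        (D : Tensor3 (Fin n) (Fin n) (Fin n ⊕ Fin q)),
      IsSlope xhat p s Θ →
      IsSlope (fun y : Fin n ⊕ Fin q → ℝ => C *ᵥ H (y ∘ Sum.inl) (y ∘ Sum.inr))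
        (graphMap xhat p) (graphMap xhat s) G →
      IsMatrixSlope (fun y : Fin n ⊕ Fin q → ℝ => jacX X H (y ∘ Sum.inl) (y ∘ Sum.inr))
        (graphMap xhat p) (graphMap xhat s) D →
      (∀ i, slopeBoundVec b G Θ p s i +
        ((slopeBoundMat B₀ C D Θ p s + tensorMulVec B u) *ᵥ u) i ≤ u i) →
      Set.MapsTo (fun x => x - C *ᵥ H x s) (centeredBox (xhat s) u) (centeredBox (xhat s) u) ∧
        ∃ x ∈ centeredBox (xhat s) u, H x s = 0) := by
  have hcont : ContinuousOn (fun x => H x s) (centeredBox (xhat s) u) :=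
    hH.continuousOn.comp (f := fun x => (x, s)) (by fun_prop)
      fun x hx => ⟨hxX (hM hx), hsS hs⟩
  have hmain : ∀ (b : Fin n → ℝ) (B₀ : Matrix (Fin n) (Fin n) ℝ),
      (∀ i, |(C *ᵥ H (xhat s) s) i| ≤ b i) →
      (∀ i j, |(C * jacX X H (xhat s) s - 1) i j| ≤ B₀ i j) →
      (∀ i, b i + ((B₀ + tensorMulVec B u) *ᵥ u) i ≤ u i) →
      Set.MapsTo (fun x => x - C *ᵥ H x s) (centeredBox (xhat s) u) (centeredBox (xhat s) u) ∧
        ∃ x ∈ centeredBox (xhat s) u, H x s = 0 := by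
    intro b B₀ hb hB₀ hle
    have hmaps := mapsTo_centeredBox_sub_mulVec hHxx hB hb hB₀ hle
    exact ⟨hmaps, exists_zero_of_mapsTo_centeredBox hC (fun i => (hu i).le) hcont hmaps⟩
  refine ⟨hmain, ?_⟩
  rintro z p - - rfl b B₀ hb hB₀ Θ G D hΘ hG hD hle
  exact hmain _ _ (abs_mulVec_le_slopeBoundVec hb hΘ hG)
    (abs_mul_jacX_sub_one_le_slopeBoundMat hB₀ hΘ hD) hle
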